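/- Let $A$ be a finite alphabet with at least two letters. A finite $A$-labeled directed graph (loops and multiple edges allowed) is an \emph{inverse automaton} if for every vertex $v$ and every letter $a\in A$ at most one edge labeled $a$ starts at $v$ and at most one edge labeled $a$ ends at $v$. It is a \emph{permutation automaton} if, for all $v$ and $a$, exactly one edge labeled $a$ starts at $v$ and exactly one ends at $v$; then every letter induces a permutation of the vertex set, and the group generated by these permutations is the \emph{transition group}. An inverse automaton is \emph{incomplete} if it is not a permutation automaton, and \emph{connected} if any two vertices are joined by a path in which edges may be traversed in either direction. A permutation automaton $\mathcal{C}$ over $A$ \emph{extends} an inverse automaton $\mathcal{A}$ over $A$ if there is an injective, label-preserving graph morphism $\mathcal{A}\to\mathcal{C}$. Theorem. Let $\mathcal{A}$ be a connected incomplete inverse automaton over $A$ with $m$ vertices, and let $q$ be the smallest prime larger than $m$. Then for every $n\ge m+q+2$ there exists a permutation automaton $\mathcal{C}_n$ over $A$ with $n$ vertices that extends $\mathcal{A}$ and whose transition group is the alternating group $\mathbb{A}_n$ of all even permutations of its $n$ vertices. -/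

import Mathlib

/-- An inverse automaton (folded `A`-labeled graph) with vertex set `V` over the alphabet `A`.
`Edge v a w` says that there is a positive edge from `v` to `w` with label `a`. For every letter
and every vertex there is at most one edge with that label starting at the vertex, and at most one
ending there; in particular there are no parallel edges with the same label, so that the edges are
faithfully recorded by a relation. Loops are allowed. -/
structure InverseAutomaton (A : Type*) (V : Type*) where
  Edge : V → A → V → Prop
  out_unique : ∀ {v : V} {a : A} {w w' : V}, Edge v a w → Edge v a w' → w = w'
  in_unique : ∀ {v v' : V} {a : A} {w : V}, Edge v a w → Edge v' a w → v = v'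

namespace InverseAutomaton

/-- Two vertices are adjacent if some edge, positive or inverse, leads from one to the other. -/
def Adj {A V : Type*} (𝒜 : InverseAutomaton A V) (u v : V) : Prop :=
  ∃ a : A, 𝒜.Edge u a v ∨ 𝒜.Edge v a u

/-- Connectedness: any two vertices are joined by a (possibly empty) path, where edges may be
traversed in both directions. -/
def IsConnected {A V : Type*} (𝒜 : InverseAutomaton A V) : Prop :=
  ∀ u v : V, Relation.ReflTransGen 𝒜.Adj u v

/-- A permutation automaton (complete graph): at every vertex and for every letter, an edge with
that label starts and an edge with that label ends. As the graph is folded, these edges are unique,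
so each vertex has degree `2 * |A|` (a loop contributing `2`). -/
def IsPermutationAutomaton {A V : Type*} (𝒜 : InverseAutomaton A V) : Prop :=
  ∀ (a : A) (v : V), (∃ w, 𝒜.Edge v a w) ∧ (∃ u, 𝒜.Edge u a v)

/-- The permutation `v ↦ v · a` of the vertex set induced by the letter `a` in a permutation
automaton. -/
noncomputable def letterPerm {A V : Type*} (𝒜 : InverseAutomaton A V)
    (h : 𝒜.IsPermutationAutomaton) (a : A) : Equiv.Perm V where
  toFun v := (h a v).1.choose
  invFun v := (h a v).2.choose
  left_inv v := 𝒜.in_unique (h a _).2.choose_spec (h a v).1.choose_spec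
  right_inv v := 𝒜.out_unique (h a _).1.choose_spec (h a v).2.choose_spec

theorem letterPerm_eq_iff {A V : Type*} (𝒜 : InverseAutomaton A V)
    (h : 𝒜.IsPermutationAutomaton) (a : A) (v w : V) :
    𝒜.letterPerm h a v = w ↔ 𝒜.Edge v a w :=
  ⟨fun e => e ▸ (h a v).1.choose_spec, fun e => 𝒜.out_unique (h a v).1.choose_spec e⟩

/-- The transition group of a permutation automaton: the group of permutations of the vertex set
generated by the permutations that the letters induce. -/
noncomputable def transitionGroup {A V : Type*} (𝒜 : InverseAutomaton A V)
    (h : 𝒜.IsPermutationAutomaton) : Subgroup (Equiv.Perm V) :=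
  Subgroup.closure (Set.range (𝒜.letterPerm h))

/-- `𝒞` extends `𝒜`: the labeled graph `𝒜` can be embedded into `𝒞`, that is, there is an
injective map of the vertices that carries edges to edges with the same label (as `𝒜` is folded,
the map so induced on the edges is injective too). -/
def Extends {A V W : Type*} (𝒞 : InverseAutomaton A W) (𝒜 : InverseAutomaton A V) : Prop :=
  ∃ f : V ↪ W, ∀ (v : V) (a : A) (w : V), 𝒜.Edge v a w → 𝒞.Edge (f v) a (f w)

end InverseAutomaton

/-! Adjoin to the vertex set `V` a block of `p > m` points, `p` an odd prime, and `r` further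
points. Some letter `b` has no edge leaving some vertex `u`. Complete each letter to a permutation
`π` of `V`. One letter `a ≠ b` also rotates the `p`-block; letters other than `b` get an involution
of the `r` points correcting the sign. The letter `b` is precomposed with a cycle `γ` through `u`,
the `r` points and the block; since `u` has no `b`-edge, no edge is disturbed. So all letters are
even and the group is transitive. As `p` is odd and exceeds `m`, a power of `a` is the bare
`p`-cycle `g`. Each letter maps some point of the block into the block, which forces primitivity,
and Jordan's theorem on prime cycles gives the alternating group. -/

namespace Equiv.Perm

open MulAction Subgroup

open scoped Pointwise

variable {α : Type*} [Fintype α] [DecidableEq α]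

/-! ### Jordan's theorem on cycles of prime length. -/

/-- If `c` commutes with a cycle `g`, it agrees with some power of `g` on the support of `g`. -/
theorem IsCycle.exists_zpow_eq_of_commute {g c : Perm α} (hg : g.IsCycle) (hc : Commute c g) :
    ∃ j : ℤ, ∀ x ∈ g.support, c x = (g ^ j) x := by
  obtain ⟨a, ha, hga⟩ := hg
  have hca : g (c a) ≠ c a := by
    rw [← mul_apply, ← hc.eq, mul_apply]
    exact fun h => ha (c.injective h)
  obtain ⟨j, hj⟩ := hga hca
  refine ⟨j, fun x hx => ?_⟩
  obtain ⟨i, rfl⟩ := hga (mem_support.1 hx)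
  rw [← mul_apply, (hc.zpow_right i).eq, mul_apply, ← hj, ← mul_apply, ← mul_apply,
    ← zpow_add, ← zpow_add, add_comm]

/-- The pointwise stabilizer in a permutation group of the complement of a set of prime size `p`
has order not divisible by `p ^ 2`. -/
theorem not_sq_dvd_card_of_fixes {p : ℕ} (hp : p.Prime) (s : Finset α) (hs : s.card = p)
    (K : Subgroup (Perm α)) (hK : ∀ k ∈ K, ∀ x ∉ s, k x = x) : ¬ p ^ 2 ∣ Nat.card K := by
  intro h
  let f : K → {f : Perm α // ∀ a, ¬ a ∈ s → f a = a} := fun k => ⟨k, hK k k.2⟩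
  let F : Subgroup (Perm α) := fixingSubgroup (Perm α) ((s : Set α)ᶜ)
  have hKF : K ≤ F := fun k hk => by
    rw [mem_fixingSubgroup_iff]
    intro y hy
    exact hK k hk y (by simpa using hy)
  have hF : Nat.card F = p.factorial := by
    have e : F ≃ {f : Perm α // ∀ a, ¬ a ∈ s → f a = a} :=
      Equiv.subtypeEquivRight fun k => by
        simp [F, mem_fixingSubgroup_iff]
    rw [Nat.card_congr (e.trans (Perm.subtypeEquivSubtypePerm (· ∈ s)).symm), Nat.card_perm]
    simp [hs]
  have h1 : p ^ 2 ∣ p.factorial := hF ▸ h.trans (Subgroup.card_dvd_of_le hKF)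
  rw [← Nat.mul_factorial_pred hp.ne_zero, pow_two] at h1
  have h2 := Nat.dvd_of_mul_dvd_mul_left hp.pos h1
  rw [hp.dvd_factorial] at h2
  have := hp.pos
  omega

/-- A Frattini argument: if `h` in `G` maps the fixed points of a cycle `g` of prime order to
fixed points of `g`, then it can be modified on the support of `g` so as to
normalize `⟨g⟩`. -/
theorem exists_conj_eq_zpow {p : ℕ} (hp : p.Prime) {G : Subgroup (Perm α)} {g h : Perm α}
    (hgG : g ∈ G) (hg : g.IsCycle) (hgp : g.support.card = p) (hhG : h ∈ G)
    (hh : ∀ x ∉ g.support, h x ∉ g.support) :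
    ∃ h' ∈ G, (∀ x ∉ g.support, h' x = h x) ∧ ∃ k : ℤ, h' * g * h'⁻¹ = g ^ k := by
  classical
  have : Fact p.Prime := ⟨hp⟩
  let K : Subgroup (Perm α) := G ⊓ fixingSubgroup (Perm α) ((g.support : Set α)ᶜ)
  have memK : ∀ k, k ∈ K ↔ k ∈ G ∧ ∀ x ∉ g.support, k x = x := fun k => by
    simp [K, mem_fixingSubgroup_iff]
  have hord : orderOf g = p := hg.orderOf.trans hgp
  have hgK : g ∈ K := (memK g).2 ⟨hgG, fun x hx => by simpa using hx⟩
  -- An injective self-map of the finite fixed-point set is onto, so `h` preserves the support as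
  -- well.
  have hperm : ∀ x, x ∉ g.support ↔ h x ∉ g.support := by
    have hb : Set.BijOn h (g.supportᶜ : Finset α) (g.supportᶜ : Finset α) := by
      have hm : Set.MapsTo h (g.supportᶜ : Finset α) (g.supportᶜ : Finset α) := by
        intro x hx
        have := hh x (by simpa using hx)
        simpa using this
      exact ⟨hm, h.injective.injOn, Finset.surjOn_of_injOn_of_card_le _ hm h.injective.injOn le_rfl⟩
    intro x
    refine ⟨hh x, fun hx => ?_⟩
    obtain ⟨y, hy, hyx⟩ := hb.surjOn (show h x ∈ ((g.supportᶜ : Finset α) : Set α) by simpa using hx)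
    rw [← h.injective hyx]
    simpa using hy
  let g' := h * g * h⁻¹
  have hg'K : g' ∈ K := by
    refine (memK _).2 ⟨G.mul_mem (G.mul_mem hhG hgG) (G.inv_mem hhG), fun x hx => ?_⟩
    have h1 : h⁻¹ x ∉ g.support := (hperm _).2 (by simpa using hx)
    have h2 : g (h⁻¹ x) = h⁻¹ x := by simpa using h1
    simp only [g', mul_apply, h2]
    simp
  have hg'ord : orderOf g' = p := by
    rw [← hord]
    exact orderOf_injective (MulAut.conj h).toMonoidHom (MulAut.conj h).injective g
  -- Exactly one factor `p` divides the order of `K`, so `⟨g⟩` and its conjugate `⟨g'⟩` are both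
  -- Sylow in `K`; the conjugating element fixes everything off the support.
  have hfac : (Nat.card K).factorization p = 1 := by
    have h1 : p ∣ Nat.card K := by
      have := orderOf_dvd_natCard (⟨g, hgK⟩ : K)
      rwa [Subgroup.orderOf_mk, hord] at this
    have h2 := not_sq_dvd_card_of_fixes hp g.support hgp K fun k hk => ((memK k).1 hk).2
    rw [hp.pow_dvd_iff_le_factorization Nat.card_pos.ne'] at h2
    rw [hp.dvd_iff_one_le_factorization Nat.card_pos.ne'] at h1
    omega
  have hcard : ∀ x : K, orderOf x = p → Nat.card (zpowers x) = p ^ (Nat.card K).factorization p :=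
    fun x hx => by rw [Nat.card_zpowers, hx, hfac, pow_one]
  let P : Sylow p K := Sylow.ofCard (zpowers ⟨g, hgK⟩) (hcard _ (by rw [Subgroup.orderOf_mk, hord]))
  let P' : Sylow p K :=
    Sylow.ofCard (zpowers ⟨g', hg'K⟩) (hcard _ (by rw [Subgroup.orderOf_mk, hg'ord]))
  obtain ⟨k, hk⟩ := MulAction.exists_smul_eq K P' P
  have hmem : k * ⟨g', hg'K⟩ * k⁻¹ ∈ zpowers (⟨g, hgK⟩ : K) := by
    have h1 : MulAut.conj k • (⟨g', hg'K⟩ : K) ∈ k • P' := by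
      exact Subgroup.smul_mem_pointwise_smul _ _ _ (mem_zpowers _)
    rw [hk] at h1
    exact h1
  obtain ⟨j, hj⟩ := mem_zpowers_iff.1 hmem
  have hkK := (memK _).1 k.2
  refine ⟨k * h, G.mul_mem hkK.1 hhG, fun x hx => hkK.2 _ (hh x hx), j, ?_⟩
  have := congrArg Subtype.val hj
  simp only [Subgroup.coe_zpow, Subgroup.coe_mul, InvMemClass.coe_inv] at this
  rw [this]
  simp only [g']
  group

/-- Jordan's theorem on cycles of prime length (Wielandt, 13.9): a primitive permutation group
that contains a cycle of prime length fixing at least three points contains the alternating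
group. -/
theorem alternatingGroup_le_of_isPreprimitive_of_isCycle_mem {p : ℕ} (hp : p.Prime)
    {G : Subgroup (Perm α)} (hG : IsPreprimitive G α) {g : Perm α} (hgG : g ∈ G)
    (hg : g.IsCycle) (hgp : g.support.card = p) (hcard : p + 3 ≤ Fintype.card α) :
    alternatingGroup α ≤ G := by
  classical
  have htrans : IsMultiplyPretransitive G α (Fintype.card α - p) := by
    let s : Set α := (g.support : Set α)ᶜ
    have hs : s.ncard = (Fintype.card α - p - 1) + 1 := by
      rw [Set.ncard_compl, Set.ncard_coe_finset, Nat.card_eq_fintype_card, hgp]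
      omega
    have h2 := hp.two_le
    have := isPretransitive_of_isCycle_mem hg hgG
    have hprim : IsPreprimitive (fixingSubgroup G s) (SubMulAction.ofFixingSubgroup G s) := by
      apply IsPreprimitive.of_prime_card
      convert hp
      rw [← hgp, ← Set.ncard_coe_finset]
      change (SubMulAction.ofFixingSubgroup G s : Set α).ncard = _
      congr 1
      ext x
      simp [s, SubMulAction.mem_ofFixingSubgroup_iff]
    have h3 := hG.isMultiplyPreprimitive hs (by rw [Nat.card_eq_fintype_card]; omega) hprim
    have := h3.isMultiplyPretransitive
    apply isMultiplyPretransitive_of_le' (n := Fintype.card α - p - 1 + 2)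
    · omega
    · rw [ENat.card_eq_coe_fintype_card]
      exact_mod_cast (by omega)
  have hcompl : Fintype.card {x // x ∉ g.support} = Fintype.card α - p := by
    rw [Fintype.card_subtype_compl, Fintype.card_coe, hgp]
  -- High transitivity realizes every permutation of the fixed points in `G`; the Frattini argument
  -- makes the realization normalize `⟨g⟩`.
  have key : ∀ τ : Perm α, (∀ x ∉ g.support, τ x ∉ g.support) →
      ∃ h ∈ G, (∀ x ∉ g.support, h x = τ x) ∧ ∃ k : ℤ, h * g * h⁻¹ = g ^ k := by
    intro τ hτ
    let e : Fin (Fintype.card α - p) ≃ {x // x ∉ g.support} := (Fintype.equivFinOfCardEq hcompl).symm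
    let ι : Fin (Fintype.card α - p) ↪ α := e.toEmbedding.trans (Function.Embedding.subtype _)
    obtain ⟨h, hh⟩ := htrans.exists_smul_eq ι (ι.trans τ.toEmbedding)
    have hhτ : ∀ x ∉ g.support, (h : Perm α) x = τ x := by
      intro x hx
      have := DFunLike.congr_fun hh (e.symm ⟨x, hx⟩)
      simp only [ι, Function.Embedding.smul_apply, Function.Embedding.trans_apply, Equiv.coe_toEmbedding,
        Equiv.apply_symm_apply, Function.Embedding.subtype_apply] at this
      exact this
    obtain ⟨h', hh'G, hh', hk⟩ := exists_conj_eq_zpow hp hgG hg hgp h.2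
      (fun x hx => by rw [hhτ x hx]; exact hτ x hx)
    exact ⟨h', hh'G, fun x hx => (hh' x hx).trans (hhτ x hx), hk⟩
  obtain ⟨x, y, z, hx, hy, hz, hxy, hxz, hyz⟩ :
      ∃ x y z, x ∈ g.supportᶜ ∧ y ∈ g.supportᶜ ∧ z ∈ g.supportᶜ ∧ x ≠ y ∧ x ≠ z ∧ y ≠ z := by
    rw [← Finset.two_lt_card_iff, Finset.card_compl]
    omega
  rw [Finset.mem_compl] at hx hy hz
  have hswap : ∀ a b, a ∉ g.support → b ∉ g.support → ∀ x ∉ g.support, swap a b x ∉ g.support := by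
    intro a b ha hb x hx
    rw [swap_apply_def]
    split_ifs <;> assumption
  obtain ⟨h₁, hG₁, hs₁, k₁, hk₁⟩ := key (swap y x) (hswap _ _ hy hx)
  obtain ⟨h₂, hG₂, hs₂, k₂, hk₂⟩ := key (swap y z) (hswap _ _ hy hz)
  have hi : ∀ (a b : α) (h : Perm α), a ∉ g.support → b ∉ g.support →
      (∀ x ∉ g.support, h x = swap a b x) → ∀ x ∉ g.support, h⁻¹ x = swap a b x := by
    intro a b h ha hb hs x hx
    rw [inv_eq_iff_eq, hs _ (hswap _ _ ha hb x hx), swap_apply_self]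
  have hi₁ := hi _ _ h₁ hy hx hs₁
  have hi₂ := hi _ _ h₂ hy hz hs₂
  have hc12 : ∀ (a b : Perm α) (k l : ℤ), a * g * a⁻¹ = g ^ k → b * g * b⁻¹ = g ^ l →
      (a * b) * g * (a * b)⁻¹ = g ^ (k * l) := by
    intro a b k l ha hb
    rw [zpow_mul, ← ha, conj_zpow, ← hb]
    group
  -- Automorphisms of the cyclic group `⟨g⟩` commute, so a commutator of normalizing elements
  -- centralizes `g`.
  have hcomm : Commute (h₁⁻¹ * h₂⁻¹ * h₁ * h₂) g := by
    have e1 := hc12 _ _ _ _ hk₁ hk₂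
    have e2 := hc12 _ _ _ _ hk₂ hk₁
    rw [mul_comm k₂, ← e1] at e2
    have e3 : (h₁ * h₂) * g = (h₂ * h₁) * g * (h₂ * h₁)⁻¹ * (h₁ * h₂) := by
      rw [e2, inv_mul_cancel_right]
    calc h₁⁻¹ * h₂⁻¹ * h₁ * h₂ * g = (h₂ * h₁)⁻¹ * ((h₁ * h₂) * g) := by group
      _ = g * (h₁⁻¹ * h₂⁻¹ * h₁ * h₂) := by rw [e3]; group
  obtain ⟨j, hj⟩ := hg.exists_zpow_eq_of_commute hcomm
  have hfix : ∀ (j : ℤ), ∀ x ∉ g.support, (g ^ j) x = x := fun j x hx =>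
    zpow_apply_eq_self_of_apply_eq_self (by simpa using hx) j
  -- The power of `g` cancels the commutator on the support; elsewhere only the commutator of two
  -- overlapping transpositions remains, a 3-cycle.
  have hd : h₁⁻¹ * h₂⁻¹ * h₁ * h₂ * g ^ (-j) = (swap y x * swap y z) * (swap y x * swap y z) := by
    ext t
    by_cases ht : t ∈ g.support
    · have ht' : (g ^ (-j)) t ∈ g.support := by rwa [zpow_apply_mem_support]
      have hne : ∀ a ∉ g.support, t ≠ a := fun a ha h => ha (h ▸ ht)
      rw [mul_apply, hj _ ht', ← mul_apply, ← zpow_add, add_neg_cancel, zpow_zero]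
      simp [swap_apply_of_ne_of_ne, hne x hx, hne y hy, hne z hz]
    · simp only [mul_apply]
      have m1 := hswap _ _ hy hz t ht
      have m2 := hswap _ _ hy hx _ m1
      have m3 := hswap _ _ hy hz _ m2
      rw [hfix _ t ht, hs₂ t ht, hs₁ _ m1, hi₂ _ m2, hi₁ _ m3]
  refine alternatingGroup_le_of_isPreprimitive_of_isThreeCycle_mem hG
    (isThreeCycle_swap_mul_swap_same hxy.symm hyz hxz).isThreeCycle_sq ?_
  rw [← hd]
  exact G.mul_mem (G.mul_mem (G.mul_mem (G.mul_mem (G.inv_mem hG₁) (G.inv_mem hG₂)) hG₁) hG₂)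
    (G.zpow_mem hgG _)

/-! ### Primitivity from a prime cycle. -/

/-- A transitive permutation group generated by permutations each of which moves a point of the
support of a fixed cycle `g` of prime length in the group to a point of this support is
primitive. -/
theorem isPreprimitive_closure_of_isCycle_mem {p : ℕ} (hp : p.Prime) {S : Set (Perm α)}
    (hG : IsPretransitive (closure S) α) {g : Perm α} (hgG : g ∈ closure S)
    (hg : g.IsCycle) (hgp : g.support.card = p)
    (hS : ∀ σ ∈ S, ∃ x ∈ g.support, σ x ∈ g.support) : IsPreprimitive (closure S) α := by
  obtain ⟨a, ha, hga⟩ := id hg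
  refine IsPreprimitive.of_isTrivialBlock_base a fun {B} haB hB => ?_
  have meet : ∀ (σ : closure S) (x), x ∈ B → (σ : Perm α) x ∈ B → σ ∈ stabilizer (closure S) B :=
    fun σ x hx hσ => hB.smul_eq_of_mem hx hσ
  -- If `g` stabilizes the block, the block contains the support, so every generator stabilizes it.
  -- Otherwise a second point, fixed by `g` or of the form `g ^ i a` with `i` prime to `p`, would
  -- force `g` to stabilize it.
  by_cases hgB : (⟨g, hgG⟩ : closure S) ∈ stabilizer (closure S) B
  · right
    have hsub : ∀ x ∈ g.support, x ∈ B := by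
      intro x hx
      obtain ⟨i, rfl⟩ := hga (mem_support.1 hx)
      have h1 : (⟨g, hgG⟩ : closure S) ^ i • B = B := (stabilizer (closure S) B).zpow_mem hgB i
      rw [← h1]
      exact ⟨a, haB, rfl⟩
    have hall : ∀ σ (hσ : σ ∈ closure S), (⟨σ, hσ⟩ : closure S) ∈ stabilizer (closure S) B := by
      intro σ hσ
      induction hσ using closure_induction with
      | mem σ h =>
        obtain ⟨x, hx, hσx⟩ := hS σ h
        exact meet _ x (hsub x hx) (hsub _ hσx)
      | one => exact one_mem _
      | mul x y hx hy h1 h2 => exact mul_mem h1 h2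
      | inv x hx h1 => exact inv_mem h1
    rw [Set.eq_univ_iff_forall]
    intro x
    obtain ⟨σ, rfl⟩ := hG.exists_smul_eq a x
    have h1 : σ • B = B := hall σ σ.2
    rw [← h1]
    exact ⟨a, haB, rfl⟩
  · left
    suffices ∀ b ∈ B, b = a from fun b hb c hc => (this b hb).trans (this c hc).symm
    intro b hb
    by_contra hba
    apply hgB
    by_cases hgb : g b = b
    · exact meet _ b hb (by simpa [hgb] using hb)
    · obtain ⟨i, rfl⟩ := hga hgb
      have h1 : (⟨g, hgG⟩ : closure S) ^ i ∈ stabilizer (closure S) B := meet _ a haB (by simpa using hb)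
      have h2 : (⟨g, hgG⟩ : closure S) ^ (p : ℤ) = 1 := by
        ext1
        simp [← hgp, ← hg.orderOf, pow_orderOf_eq_one]
      have hcop : IsCoprime i (p : ℤ) := by
        rw [isCoprime_comm, (Nat.prime_iff_prime_int.1 hp).coprime_iff_not_dvd]
        rintro ⟨t, rfl⟩
        have h3 : g ^ (p : ℤ) = 1 := congrArg Subtype.val h2
        apply hba
        rw [zpow_mul, h3, one_zpow, one_apply]
      obtain ⟨u, v, huv⟩ := hcop
      have h3 : (⟨g, hgG⟩ : closure S) = ((⟨g, hgG⟩ : closure S) ^ i) ^ u := by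
        conv_lhs => rw [← zpow_one (⟨g, hgG⟩ : closure S), ← huv, zpow_add, mul_comm v,
          zpow_mul _ _ v, h2, one_zpow, mul_one, mul_comm, zpow_mul]
      rw [h3]
      exact zpow_mem h1 u

end Equiv.Perm

/-! ### Completions, signs and connecting cycles. -/

open Equiv

/-- A partial injection of a finite set, given as a relation, extends to a permutation. -/
theorem exists_perm_extending_relation {V : Type*} [Finite V] (R : V → V → Prop)
    (hout : ∀ {v w w'}, R v w → R v w' → w = w') (hin : ∀ {v v' w}, R v w → R v' w → v = v') :
    ∃ σ : Perm V, ∀ v w, R v w → σ v = w := by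
  let f : {v // ∃ w, R v w} → V := fun v => v.2.choose
  have hf : ∀ v, R v.1 (f v) := fun v => v.2.choose_spec
  have hinj : Function.Injective f := fun v v' h => Subtype.ext (hin (hf v) (h ▸ hf v'))
  obtain ⟨σ, hσ⟩ := Perm.exists_extending_pair _ f Subtype.val_injective hinj
  exact ⟨σ, fun v w h => (hσ ⟨v, w, h⟩).trans (hout (hf ⟨v, w, h⟩) h)⟩

/-- Supplies the sign correction on the `r` extra points; being an involution, it disappears in even
powers. -/
theorem exists_involution_sign_eq {r : ℕ} (hr : 2 ≤ r) (ε : ℤˣ) :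
    ∃ ρ : Perm (Fin r), Perm.sign ρ = ε ∧ ρ ^ 2 = 1 := by
  rcases Int.units_eq_one_or ε with rfl | rfl
  · exact ⟨1, by simp⟩
  · refine ⟨swap ⟨0, by omega⟩ ⟨1, by omega⟩, Perm.sign_swap (by simp), ?_⟩
    rw [sq, swap_mul_self]

theorem List.sign_formPerm_of_nodup {α : Type*} [Fintype α] [DecidableEq α] {l : List α}
    (h : l.Nodup) (h2 : 2 ≤ l.length) : Perm.sign l.formPerm = -(-1) ^ l.length := by
  rw [(List.isCycle_formPerm h h2).sign, List.support_formPerm_of_nodup l h, List.toFinset_card_of_nodup h]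
  rintro x rfl
  simp at h2

/-- A set containing the head of `u :: t` and closed under the steps of the cycle
`(u :: t).formPerm` that lead into `t` contains `t`. -/
theorem List.forall_mem_of_formPerm_closed {α : Type*} [DecidableEq α] {u : α} {t : List α}
    (h : (u :: t).Nodup) {S : Set α} (hu : u ∈ S)
    (hS : ∀ y ∈ S, (u :: t).formPerm y ∈ t → (u :: t).formPerm y ∈ S) : ∀ x ∈ t, x ∈ S := by
  have key : ∀ i (hi : i < (u :: t).length), (u :: t)[i] ∈ S := by
    intro i
    induction i with
    | zero => intro _; exact hu
    | succ i ih =>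
      intro hi
      have h1 := List.formPerm_apply_lt_getElem _ h i hi
      rw [← h1]
      apply hS _ (ih (by omega))
      rw [h1]
      simp
  intro x hx
  obtain ⟨i, hi, rfl⟩ := List.getElem_of_mem (List.mem_cons_of_mem u hx)
  exact key i hi

/-- A cycle of prescribed sign through `u`, all of `Fin r` and one or two points of `Fin p`. -/
theorem exists_connecting_cycle {V : Type*} [Fintype V] [DecidableEq V] (u : V) {p r : ℕ}
    (hp : 3 ≤ p) (ε : ℤˣ) :
    ∃ γ : Perm (V ⊕ (Fin p ⊕ Fin r)), Perm.sign γ = ε ∧ (∀ v ≠ u, γ (.inl v) = .inl v) ∧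
      (∃ x y : Fin p, γ (.inr (.inl x)) = .inr (.inl y)) ∧
      ∀ S : Set (V ⊕ (Fin p ⊕ Fin r)), .inl u ∈ S →
        (∀ y ∈ S, ∀ t, γ y = .inr t → .inr t ∈ S) →
        (∀ i, .inr (.inr i) ∈ S) ∧ ∃ j, .inr (.inl j) ∈ S := by
  let ι : Fin r → V ⊕ (Fin p ⊕ Fin r) := fun i => .inr (.inr i)
  have hι : Function.Injective ι := Sum.inr_injective.comp Sum.inr_injective
  have main : ∀ D : List (Fin p), D.Nodup → D ≠ [] →
      -(-1) ^ (1 + r + D.length) = ε →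
      (∃ x y : Fin p, List.formPerm (.inl u :: (((List.finRange r).map ι) ++
        (D.map fun j => (.inr (.inl j) : V ⊕ (Fin p ⊕ Fin r))))) (.inr (.inl x)) = .inr (.inl y)) →
      ∃ γ : Perm (V ⊕ (Fin p ⊕ Fin r)), Perm.sign γ = ε ∧ (∀ v ≠ u, γ (.inl v) = .inl v) ∧
      (∃ x y : Fin p, γ (.inr (.inl x)) = .inr (.inl y)) ∧
      ∀ S : Set (V ⊕ (Fin p ⊕ Fin r)), .inl u ∈ S →
        (∀ y ∈ S, ∀ t, γ y = .inr t → .inr t ∈ S) →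
        (∀ i, .inr (.inr i) ∈ S) ∧ ∃ j, .inr (.inl j) ∈ S := by
    intro D hD hD0 hε hxy
    have hnd : (Sum.inl u :: (((List.finRange r).map ι) ++
        (D.map fun j => (.inr (.inl j) : V ⊕ (Fin p ⊕ Fin r))))).Nodup := by
      rw [List.nodup_cons, List.nodup_append]
      refine ⟨by simp [ι], (List.nodup_finRange r).map hι,
        hD.map (Sum.inr_injective.comp Sum.inl_injective), ?_⟩
      simp [ι]
    have hpos := List.length_pos_iff.2 hD0
    refine ⟨_, ?_, ?_, hxy, ?_⟩
    · rw [List.sign_formPerm_of_nodup hnd (by simp; omega), ← hε]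
      congr 2
      simp
      ring
    · intro v hv
      apply List.formPerm_apply_of_notMem
      simp [ι, hv]
    -- Only steps landing outside `V` are available: there alone does a later factor acting on `V`
    -- leave the value of `γ` unchanged.
    · intro S hu hS
      have := List.forall_mem_of_formPerm_closed hnd hu fun y hy hmem => by
        generalize hz : List.formPerm _ y = z at hmem ⊢
        rcases z with z | z
        · simp [ι] at hmem
        · exact hS y hy z hz
      refine ⟨fun i => this _ (by simp [ι]), ?_⟩
      obtain ⟨j, hj⟩ := List.exists_mem_of_ne_nil D hD0
      exact ⟨j, this _ (by simp [hj])⟩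
  let d₀ : Fin p := ⟨0, by omega⟩
  let d₁ : Fin p := ⟨1, by omega⟩
  -- Using one or two block points switches the parity of the cycle length, so either sign is
  -- attainable.
  by_cases hε : -(-1) ^ (1 + r + 1) = ε
  · refine main [d₀] (by simp) (by simp) (by simpa using hε) ⟨d₁, d₁, ?_⟩
    apply List.formPerm_apply_of_notMem
    simp [ι, d₀, d₁]
  · refine main [d₀, d₁] (by simp [d₀, d₁]) (by simp) ?_ ⟨d₀, d₁, ?_⟩
    · rw [← ne_eq, Int.units_ne_iff_eq_neg] at hε
      rw [← neg_eq_iff_eq_neg.2 hε, List.length_cons, List.length_singleton, ← add_assoc,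
        pow_succ _ (1 + r + 1), mul_neg_one]
    · have hnd : (Sum.inl u :: (((List.finRange r).map ι) ++
          ([d₀, d₁].map fun j => (.inr (.inl j) : V ⊕ (Fin p ⊕ Fin r))))).Nodup := by
        rw [List.nodup_cons, List.nodup_append]
        refine ⟨by simp [ι], (List.nodup_finRange r).map hι, by simp [d₀, d₁], ?_⟩
        simp [ι]
      have := List.formPerm_apply_lt_getElem _ hnd (r + 1) (by simp)
      simpa [List.getElem_cons, List.getElem_append] using this

/-- The permutation `c` of the middle summand of `V ⊕ (W ⊕ R)`, as a cycle of the whole. -/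
theorem isCycle_sumCongr_one {V W R : Type*} {c : Perm W} (hc : c.IsCycle) :
    (Perm.sumCongr (1 : Perm V) (Perm.sumCongr c (1 : Perm R))).IsCycle := by
  obtain ⟨a, ha, hca⟩ := hc
  refine ⟨.inr (.inl a), by simpa using ha, ?_⟩
  rintro (v | w | i) h
  · simp at h
  · obtain ⟨k, hk⟩ := hca (y := w) (by simpa using h)
    refine ⟨k, ?_⟩
    let f : Perm W →* Perm (V ⊕ (W ⊕ R)) := (Perm.sumCongrHom V (W ⊕ R)).comp
      ((MonoidHom.inr _ _).comp ((Perm.sumCongrHom W R).comp (MonoidHom.inl _ _)))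
    change (f c ^ k) _ = _
    rw [← map_zpow]
    simp [f, Perm.sumCongrHom, hk]
  · simp at h

theorem support_sumCongr_one {V W R : Type*} [Fintype V] [DecidableEq V] [Fintype W]
    [DecidableEq W] [Fintype R] [DecidableEq R] {c : Perm W} :
    (Perm.sumCongr (1 : Perm V) (Perm.sumCongr c (1 : Perm R))).support =
      c.support.map (Function.Embedding.inl.trans Function.Embedding.inr) := by
  ext (v | w | i) <;> simp

/-- If a letter is defined at every vertex, it is an injective self-map of a finite set, hence onto;
so no incoming edge can be missing alone. -/
theorem InverseAutomaton.exists_no_out_edge {A V : Type*} [Finite V] (𝒜 : InverseAutomaton A V)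
    (hinc : ¬ 𝒜.IsPermutationAutomaton) : ∃ b u, ∀ w, ¬ 𝒜.Edge u b w := by
  by_contra! hout
  apply hinc
  intro a v
  refine ⟨hout a v, ?_⟩
  choose f hf using hout a
  have hinj : Function.Injective f := fun v v' h => 𝒜.in_unique (hf v) (h ▸ hf v')
  obtain ⟨u, rfl⟩ := Finite.surjective_of_injective hinj v
  exact ⟨u, hf u⟩

/-- If `π` permutes fewer than `p` points, then some power of
`π ⊕ c ⊕ ρ`, with `c` of prime order `p` and `ρ` an involution, is `1 ⊕ c ⊕ 1`. -/
theorem exists_pow_sumCongr_eq {V W R : Type*} [Fintype V] {p : ℕ} (hp : p.Prime) (hp3 : 3 ≤ p)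
    (hV : Fintype.card V < p) {π : Perm V} {c : Perm W} {ρ : Perm R} (hc : orderOf c = p)
    (hρ : ρ ^ 2 = 1) :
    ∃ k : ℕ, (Perm.sumCongr π (Perm.sumCongr c ρ)) ^ k =
      Perm.sumCongr (1 : Perm V) (Perm.sumCongr c (1 : Perm R)) := by
  classical
  have hpow : ∀ k : ℕ, (Perm.sumCongr π (Perm.sumCongr c ρ)) ^ k =
      Perm.sumCongr (π ^ k) (Perm.sumCongr (c ^ k) (ρ ^ k)) := by
    intro k
    induction k with
    | zero => simp
    | succ k ih => rw [pow_succ, ih, Perm.sumCongr_mul, Perm.sumCongr_mul, ← pow_succ, ← pow_succ,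
        ← pow_succ]
  -- This exponent kills `π` and `ρ`, yet is prime to `p` because `p` is odd and larger than the
  -- size of `V`.
  let N := 2 * (Fintype.card V).factorial
  have hN : N.Coprime (orderOf c) := by
    rw [hc, Nat.coprime_comm, hp.coprime_iff_not_dvd, hp.dvd_mul, hp.dvd_factorial]
    have : p ∣ 2 → p ≤ 2 := Nat.le_of_dvd two_pos
    omega
  obtain ⟨k, hk⟩ := exists_pow_eq_self_of_coprime hN
  refine ⟨N * k, ?_⟩
  have h1 : π ^ N = 1 := by
    rw [← orderOf_dvd_iff_pow_eq_one]
    exact (Fintype.card_perm (α := V) ▸ orderOf_dvd_card).trans (Dvd.intro_left _ rfl)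
  have h2 : ρ ^ N = 1 := by rw [pow_mul, hρ, one_pow]
  rw [hpow, pow_mul π, pow_mul c, pow_mul ρ, h1, h2, hk, one_pow, one_pow]

/-! ### The construction of the letters. -/

theorem InverseAutomaton.exists_perms_closure_eq_alternatingGroup {A V : Type*} [Nontrivial A]
    [Fintype V] [DecidableEq V] (𝒜 : InverseAutomaton A V) (hconn : 𝒜.IsConnected)
    (hinc : ¬ 𝒜.IsPermutationAutomaton) {p r : ℕ} (hp : p.Prime) (hp3 : 3 ≤ p)
    (hV : Fintype.card V < p) (hcard : p = 3 ∨ 3 ≤ Fintype.card V + r)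
    (hρ : ∀ π : Perm V, ∃ ρ : Perm (Fin r), Perm.sign ρ = Perm.sign π ∧ ρ ^ 2 = 1) :
    ∃ τ : A → Perm (V ⊕ (Fin p ⊕ Fin r)),
      (∀ v x w, 𝒜.Edge v x w → τ x (.inl v) = .inl w) ∧
      Subgroup.closure (Set.range τ) = alternatingGroup (V ⊕ (Fin p ⊕ Fin r)) := by
  classical
  obtain ⟨b, u, hu⟩ := 𝒜.exists_no_out_edge hinc
  obtain ⟨a, hab⟩ := exists_ne b
  choose π hπ using fun x => exists_perm_extending_relation (fun v w => 𝒜.Edge v x w)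
    𝒜.out_unique 𝒜.in_unique
  choose ρ hρs hρ2 using fun x => hρ (π x)
  obtain ⟨γ, hγs, hγV, ⟨x₀, y₀, hγxy⟩, hγ⟩ :=
    exists_connecting_cycle u (r := r) hp3 (Perm.sign (π b))
  let c : Perm (Fin p) := finRotate p
  have hc : c.IsCycle := isCycle_finRotate_of_le (by omega)
  have hcsupp : c.support = Finset.univ := support_finRotate_of_le (by omega)
  have hcord : orderOf c = p := by rw [hc.orderOf, hcsupp, Finset.card_univ, Fintype.card_fin]
  have hcsign : Perm.sign c = 1 := by
    rw [sign_finRotate]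
    exact (hp.even_sub_one (by omega)).neg_one_pow
  let τ : A → Perm (V ⊕ (Fin p ⊕ Fin r)) := fun x =>
    if x = b then Perm.sumCongr (π b) 1 * γ
    else Perm.sumCongr (π x) (Perm.sumCongr (if x = a then c else 1) (ρ x))
  have hτb : τ b = Perm.sumCongr (π b) 1 * γ := by simp [τ]
  have hτa : τ a = Perm.sumCongr (π a) (Perm.sumCongr c (ρ a)) := by simp [τ, hab]
  have hτ : ∀ x ≠ b, τ x = Perm.sumCongr (π x) (Perm.sumCongr (if x = a then c else 1) (ρ x)) :=
    fun x hx => by simp [τ, hx]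
  have hedge : ∀ v x w, 𝒜.Edge v x w → τ x (.inl v) = .inl w := by
    intro v x w h
    by_cases hx : x = b
    · subst hx
      have hvu : v ≠ u := by rintro rfl; exact hu w h
      simp [hτb, hγV v hvu, hπ _ _ _ h]
    · simp [hτ x hx, hπ _ _ _ h]
  have hsign : ∀ x, Perm.sign (τ x) = 1 := by
    intro x
    by_cases hx : x = b
    · subst hx
      rw [hτb, Perm.sign_mul, Perm.sign_sumCongr, hγs, Perm.sign_one, mul_one, Int.units_mul_self]
    · rw [hτ x hx, Perm.sign_sumCongr, Perm.sign_sumCongr, hρs]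
      split_ifs <;> simp [hcsign]
  refine ⟨τ, hedge, le_antisymm ?_ ?_⟩
  · rw [Subgroup.closure_le]
    rintro _ ⟨x, rfl⟩
    exact Perm.mem_alternatingGroup.2 (hsign x)
  set G := Subgroup.closure (Set.range τ) with hGdef
  have hτG : ∀ x, τ x ∈ G := fun x => Subgroup.subset_closure ⟨x, rfl⟩
  let g : Perm (V ⊕ (Fin p ⊕ Fin r)) := Perm.sumCongr 1 (Perm.sumCongr c 1)
  have hgG : g ∈ G := by
    obtain ⟨k, hk⟩ := exists_pow_sumCongr_eq hp hp3 hV (π := π a) hcord (hρ2 a)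
    rw [← hτa] at hk
    rw [show g = _ from hk.symm]
    exact G.pow_mem (hτG a) k
  have hg : g.IsCycle := isCycle_sumCongr_one hc
  have hmem : ∀ j, .inr (.inl j) ∈ g.support := fun j => by
    simp [g, support_sumCongr_one, hcsupp]
  have hgp : g.support.card = p := by
    simp [g, support_sumCongr_one, hcsupp]
  have hgen : ∀ σ ∈ Set.range τ, ∃ x ∈ g.support, σ x ∈ g.support := by
    rintro _ ⟨x, rfl⟩
    by_cases hx : x = b
    · subst hx
      refine ⟨_, hmem x₀, ?_⟩
      rw [hτb, Perm.mul_apply, hγxy]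
      exact hmem y₀
    · refine ⟨_, hmem x₀, ?_⟩
      rw [hτ x hx]
      exact hmem _
  have htrans : MulAction.IsPretransitive G (V ⊕ (Fin p ⊕ Fin r)) := by
    rw [MulAction.isPretransitive_iff_base (Sum.inl u)]
    let S : Set (V ⊕ (Fin p ⊕ Fin r)) := MulAction.orbit G (Sum.inl u)
    -- Orbit membership passes both ways along a generator, as connectedness allows edges to be
    -- traversed backwards.
    have hS : ∀ σ ∈ G, ∀ y, σ y ∈ S ↔ y ∈ S := fun σ hσ y => by
      rw [← MulAction.orbit_eq_iff, ← MulAction.orbit_eq_iff,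
        ← MulAction.orbit_smul (⟨σ, hσ⟩ : G) y]
      rfl
    have huS : Sum.inl u ∈ S := MulAction.mem_orbit_self _
    obtain ⟨hR, j₀, hj₀⟩ := hγ S huS fun y hy t ht => by
      have := (hS _ (hτG b) y).2 hy
      simpa [hτb, ht] using this
    have hD : ∀ j, .inr (.inl j) ∈ S := by
      intro j
      obtain ⟨k, hk⟩ := hg.exists_zpow_eq (Perm.mem_support.1 (hmem j₀)) (Perm.mem_support.1 (hmem j))
      rw [← hk]
      exact (hS _ (G.zpow_mem hgG k) _).2 hj₀
    have hVS : ∀ v, .inl v ∈ S := by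
      intro v
      induction hconn u v with
      | refl => exact huS
      | tail _ h ih =>
        obtain ⟨x, h | h⟩ := h
        · rw [← hedge _ _ _ h]
          exact (hS _ (hτG x) _).2 ih
        · rw [← hedge _ _ _ h] at ih
          exact (hS _ (hτG x) _).1 ih
    rintro (v | j | i)
    · exact hVS v
    · exact hD j
    · exact hR i
  have hprim : MulAction.IsPreprimitive G (V ⊕ (Fin p ⊕ Fin r)) :=
    Perm.isPreprimitive_closure_of_isCycle_mem hp htrans hgG hg hgp hgen
  -- For `p = 3` fewer than three fixed points may remain, but then `g` is itself a 3-cycle.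
  rcases hcard with rfl | hcard
  · exact Perm.alternatingGroup_le_of_isPreprimitive_of_isThreeCycle_mem hprim
      (card_support_eq_three_iff.1 hgp) hgG
  · refine Perm.alternatingGroup_le_of_isPreprimitive_of_isCycle_mem hp hprim hgG hg hgp ?_
    simp only [Fintype.card_sum, Fintype.card_fin]
    omega

/-! ### Transport to `Fin n` and choice of parameters. -/

/-- The permutation automaton given by a family of permutations. -/
def InverseAutomaton.ofPerms {A W : Type*} (τ : A → Perm W) : InverseAutomaton A W where
  Edge v a w := τ a v = w
  out_unique h h' := h.symm.trans h'
  in_unique {_ _ a _} h h' := (τ a).injective (h.trans h'.symm)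

theorem InverseAutomaton.isPermutationAutomaton_ofPerms {A W : Type*} (τ : A → Perm W) :
    (ofPerms τ).IsPermutationAutomaton :=
  fun a v => ⟨⟨τ a v, rfl⟩, ⟨(τ a).symm v, (τ a).apply_symm_apply v⟩⟩

theorem InverseAutomaton.transitionGroup_ofPerms {A W : Type*} (τ : A → Perm W) :
    (ofPerms τ).transitionGroup (isPermutationAutomaton_ofPerms τ) =
      Subgroup.closure (Set.range τ) := by
  rw [transitionGroup]
  congr 2
  ext a v
  exact (letterPerm_eq_iff _ (isPermutationAutomaton_ofPerms τ) a v (τ a v)).2 rfl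

theorem closure_range_permCongr_eq_alternatingGroup {A W W' : Type*} [Fintype W] [DecidableEq W]
    [Fintype W'] [DecidableEq W'] (e : W ≃ W') {τ : A → Perm W}
    (h : Subgroup.closure (Set.range τ) = alternatingGroup W) :
    Subgroup.closure (Set.range fun a => e.permCongr (τ a)) = alternatingGroup W' := by
  have h1 : (Set.range fun a => e.permCongr (τ a)) =
      (e.permCongrHom : Perm W →* Perm W') '' Set.range τ := by
    rw [← Set.range_comp]
    rfl
  rw [h1, ← MonoidHom.map_closure, h]
  ext σ
  rw [Subgroup.mem_map, Perm.mem_alternatingGroup]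
  constructor
  · rintro ⟨σ, hσ, rfl⟩
    exact (Perm.sign_permCongr e σ).trans (Perm.mem_alternatingGroup.1 hσ)
  · intro hσ
    refine ⟨e.symm.permCongr σ, Perm.mem_alternatingGroup.2 ?_, ?_⟩
    · rw [Perm.sign_permCongr, hσ]
    · ext x
      simp

theorem mainTheorem3 {A V : Type*} [Finite A] [Nontrivial A] [Finite V]
    (𝒜 : InverseAutomaton A V) (hconn : 𝒜.IsConnected) (hinc : ¬ 𝒜.IsPermutationAutomaton)
    (m q : ℕ) (hm : Nat.card V = m) (hq : IsLeast {p : ℕ | p.Prime ∧ m < p} q)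
    (n : ℕ) (hn : m + q + 2 ≤ n) :
    ∃ (𝒞 : InverseAutomaton A (Fin n)) (h𝒞 : 𝒞.IsPermutationAutomaton),
      𝒞.Extends 𝒜 ∧ 𝒞.transitionGroup h𝒞 = alternatingGroup (Fin n) := by
  classical
  have := Fintype.ofFinite V
  rw [Nat.card_eq_fintype_card] at hm
  obtain ⟨⟨hqp, hmq⟩, -⟩ := hq
  have hm0 : 0 < m := by
    obtain ⟨-, u, -⟩ := 𝒜.exists_no_out_edge hinc
    exact hm ▸ Fintype.card_pos_iff.2 ⟨u⟩
  obtain ⟨p, r, hp, hp3, hV, hcard, hρ, hnpr⟩ : ∃ p r : ℕ, p.Prime ∧ 3 ≤ p ∧ Fintype.card V < p ∧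
      (p = 3 ∨ 3 ≤ Fintype.card V + r) ∧
      (∀ π : Perm V, ∃ ρ : Perm (Fin r), Perm.sign ρ = Perm.sign π ∧ ρ ^ 2 = 1) ∧
      m + (p + r) = n := by
    have := hqp.two_le
    -- Here `q = 2` is not odd, so `p = 3` replaces it. Possibly `r = 1`, but permutations of a
    -- single vertex need no sign correction. For `m ≥ 2`, `q` is odd and the bound on `n` leaves `r
    -- ≥ 2`, room for a transposition.
    by_cases h1 : m = 1
    · have : Subsingleton V := Fintype.card_le_one_iff_subsingleton.1 (by omega)
      refine ⟨3, n - 4, Nat.prime_three, le_rfl, by omega, .inl rfl, fun π => ⟨1, ?_⟩, by omega⟩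
      rw [Subsingleton.elim π 1]
      simp
    · exact ⟨q, n - m - q, hqp, by omega, by omega, .inr (by omega),
        fun π => exists_involution_sign_eq (by omega) _, by omega⟩
  obtain ⟨τ, hτ, hgrp⟩ :=
    𝒜.exists_perms_closure_eq_alternatingGroup hconn hinc hp hp3 hV hcard hρ
  let e : V ⊕ (Fin p ⊕ Fin r) ≃ Fin n := Fintype.equivFinOfCardEq (by simp [hm, hnpr])
  refine ⟨.ofPerms fun a => e.permCongr (τ a), InverseAutomaton.isPermutationAutomaton_ofPerms _,
    ⟨Function.Embedding.inl.trans e.toEmbedding, fun v a w h => ?_⟩, ?_⟩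
  · change e.permCongr (τ a) (e (.inl v)) = e (.inl w)
    rw [Equiv.permCongr_apply, Equiv.symm_apply_apply, hτ v a w h]
  · rw [InverseAutomaton.transitionGroup_ofPerms]
    exact closure_range_permCongr_eq_alternatingGroup e hgrp
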